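/- Let $\Gamma$ be a finite graph with oriented edge set $E$ (multiple edges and self-loops allowed), with $n\ge 1$ loops, i.e. $\operatorname{rank} H_1(\Gamma,\mathbb Z)=n$, and with exactly $2n$ edges. Assume that $\Gamma$ is primitive log divergent, i.e. every subgraph $G$ with edge set $\emptyset\neq E_G\subsetneq E$ satisfies $\#E_G>2\operatorname{rank}H_1(G,\mathbb Z)$. Fix a $\mathbb Z$-basis $b_1,\dots,b_n$ of $H_1(\Gamma,\mathbb Z)\subset\mathbb Z[E]$. For $e\in E$ let $\ell_e(x)=\sum_i b_i(e)\,x_i$ be the $e$-th coordinate function on $H=H_1(\Gamma)$, and let $N_e$ be the symmetric $n\times n$ matrix of the quadratic form $\ell_e^2$. Let $q_e=(\ell_e^2,\ell_e^2,\ell_e^2,\ell_e^2)$ be the associated Feynman quadric on $H^4$, i.e. $q_e(Z)=\sum_{a=1}^4\ell_e(Z^{(a)})^2$, and let $M_e$ be its symmetric $4n\times4n$ matrix. Let $\Psi_\Gamma\in\mathbb Z[A_e : e\in E]$ be the graph polynomial of $\Gamma$, i.e. the configuration polynomial $\det\big(\sum_e A_e\,(b_i(e)b_j(e))_{i,j}\big)$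 of $H_1(\Gamma,\mathbb Z)\subset\mathbb Z[E]$. Then: 1. $M_e$ is block diagonal with four diagonal blocks equal to $N_e$, for every $e\in E$; 2. $\Psi_\Gamma=\det\big(\sum_e A_eN_e\big)$, and $\Phi:=\det\big(\sum_eA_eM_e\big)=\Psi_\Gamma^4$; 3. the two integrals below converge absolutely, and there is $c\in\mathbb Q^\times$ such that $$P(\Gamma):=\int_{\mathbb P^{4n-1}(\mathbb R)}\frac{\Omega_{4n-1}(Z)}{\prod_{e\in E}q_e(Z)}=c\,\pi^{2n}\int_{\sigma^{2n-1}(\mathbb R)}\frac{\Omega_{2n-1}(A)}{\Psi_\Gamma(A)^2}.$$ Here $\sigma^{2n-1}(\mathbb R)\subset\mathbb P^{2n-1}(\mathbb R)$ is the set of points with nonnegative projective coordinates, and the integral of a form $f\,\Omega$, with $f$ homogeneous of degree minus the number of coordinates, is computed in an affine chart in which one coordinate equals $1$, where $\Omega$ is Lebesgue measure in the remaining coordinates. The constant $c$ does not depend on the charts chosen on the two sides. -/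

import Mathlib

open MeasureTheory

noncomputable section

/-- A multigraph with vertex type `V` and edge type `E`, with a chosen orientation of its edges.
Multiple edges and self-loops are allowed. -/
structure OrientedGraph (V E : Type*) where
  /-- the vertex which the edge exits -/
  src : E → V
  /-- the vertex which the edge enters -/
  tgt : E → V

namespace OrientedGraph

variable {V E : Type*} [DecidableEq V]

/-- `+1` if `e` exits `v`, `-1` if `e` enters `v` (so `0` for a self-loop at `v`). -/
def sign (Γ : OrientedGraph V E) (v : V) (e : E) : ℤ :=
  (if Γ.src e = v then 1 else 0) - (if Γ.tgt e = v then 1 else 0)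

/-- The boundary map `∂ : ℤ[E] → ℤ[V]`, `∂ e = ∑ v, sign(v, e) v`. -/
def boundary [Fintype E] (Γ : OrientedGraph V E) : (E → ℤ) →ₗ[ℤ] (V → ℤ) :=
  (Matrix.of fun v e => Γ.sign v e).mulVecLin

/-- `H₁(Γ, ℤ) = ker ∂ ⊆ ℤ[E]`. -/
def H1 [Fintype E] (Γ : OrientedGraph V E) : Submodule ℤ (E → ℤ) :=
  LinearMap.ker Γ.boundary

/-- The number of loops (first Betti number). -/
def loopNumber [Fintype E] (Γ : OrientedGraph V E) : ℕ :=
  Module.finrank ℤ Γ.H1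

/-- The subgraph with edge set `F`. -/
def restrict (Γ : OrientedGraph V E) (F : Finset E) : OrientedGraph V {e // e ∈ F} where
  src e := Γ.src e
  tgt e := Γ.tgt e

/-- More edges than twice the number of loops. -/
def IsConvergent [Fintype E] (Γ : OrientedGraph V E) : Prop :=
  2 * Γ.loopNumber < Fintype.card E

/-- Exactly twice as many edges as loops. -/
def IsLogDivergent [Fintype E] (Γ : OrientedGraph V E) : Prop :=
  Fintype.card E = 2 * Γ.loopNumber

/-- Logarithmically divergent, with every proper subgraph (having at least one edge) convergent. -/
def IsPrimitiveLogDivergent [Fintype E] (Γ : OrientedGraph V E) : Prop :=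
  Γ.IsLogDivergent ∧
    ∀ F : Finset E, F.Nonempty → F ≠ Finset.univ → (Γ.restrict F).IsConvergent

end OrientedGraph

/-- The configuration polynomial `Ψ_W(A) = det (∑ e, A_e M_e)` of a configuration `W ⊆ R[E]` with
basis `b`; here `M_e = (b_i(e) b_j(e))_{ij}` is the matrix of the rank one form `(e^∨|_W)²`. -/
def configurationPolynomial {R E ι : Type*} [CommRing R] [Fintype E] [Fintype ι] [DecidableEq ι]
    {W : Submodule R (E → R)} (b : Module.Basis ι R W) : MvPolynomial E R :=
  (∑ e : E, MvPolynomial.X (R := R) e •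
    (Matrix.of fun i j => (b i : E → R) e * (b j : E → R) e).map MvPolynomial.C).det

/-- `det (∑ e, A_e M_e)` for a family of square matrices `M_e`. -/
def discriminantPolynomial {E ι : Type*} [Fintype E] [Fintype ι] [DecidableEq ι]
    (M : E → Matrix ι ι ℚ) : MvPolynomial E ℚ :=
  (∑ e : E, MvPolynomial.X (R := ℚ) e • (M e).map MvPolynomial.C).det

namespace OrientedGraph

variable {V E : Type*} [DecidableEq V] [Fintype E]

/-- The graph polynomial `Ψ_Γ`: the configuration polynomial of `H₁(Γ, ℤ) ⊆ ℤ[E]`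
(a change of the `ℤ`-basis multiplies it by `(±1)² = 1`). -/
def graphPolynomial (Γ : OrientedGraph V E) {n : ℕ} (b : Module.Basis (Fin n) ℤ Γ.H1) :
    MvPolynomial E ℤ :=
  configurationPolynomial b

variable {Γ : OrientedGraph V E} {n : ℕ}

/-- The linear form `ℓ_e = e^∨` on `H = H₁(Γ) ⊗ K ≅ Kⁿ`, in the coordinates of the basis `b`. -/
def edgeForm (K : Type*) [CommRing K] (b : Module.Basis (Fin n) ℤ Γ.H1) (e : E) :
    (Fin n → K) →ₗ[K] K :=
  ∑ i, (((b i : E → ℤ) e : ℤ) : K) • LinearMap.proj i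

/-- The form `ℓ_e²` on `H`. -/
def edgeSquare (K : Type*) [CommRing K] (b : Module.Basis (Fin n) ℤ Γ.H1) (e : E) :
    QuadraticForm K (Fin n → K) :=
  QuadraticMap.linMulLin (edgeForm K b e) (edgeForm K b e)

/-- The Feynman quadric `q_e = (ℓ_e², ℓ_e², ℓ_e², ℓ_e²)` on `H⁴`. The coordinates on `H⁴` are the
`Z (i, a)` where `a : Fin 4` is the number of the summand `H` and `i : Fin n` the coordinate
in it. -/
def feynmanQuadric (K : Type*) [CommRing K] (b : Module.Basis (Fin n) ℤ Γ.H1) (e : E) :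
    QuadraticForm K (Fin n × Fin 4 → K) :=
  ∑ a : Fin 4, (edgeSquare K b e).comp (LinearMap.funLeft K K fun i => (i, a))

end OrientedGraph

/-- The point of `ℝ^ι` with `i₀`-th coordinate `1` and the other coordinates `z`: it represents the
point of `ℙ(ℝ^ι)` with affine coordinates `z` in the chart `Z_{i₀} ≠ 0`. -/
def chartPoint {ι : Type*} [DecidableEq ι] (i₀ : ι) (z : {i // i ≠ i₀} → ℝ) : ι → ℝ :=
  fun i => if h : i = i₀ then 1 else z ⟨i, h⟩

/-- For `f` homogeneous of degree `-#ι`, the integral of `f Ω` over `ℙ(ℝ^ι)`, computed in the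
chart `Z_{i₀} = 1`, where `Ω` restricts to Lebesgue measure. -/
def projectiveIntegral {ι : Type*} [Fintype ι] [DecidableEq ι] (i₀ : ι) (f : (ι → ℝ) → ℝ) : ℝ :=
  ∫ z : {i // i ≠ i₀} → ℝ, f (chartPoint i₀ z)

/-- Absolute convergence of `projectiveIntegral`. -/
def ProjectiveIntegrable {ι : Type*} [Fintype ι] [DecidableEq ι] (i₀ : ι) (f : (ι → ℝ) → ℝ) :
    Prop :=
  Integrable fun z : {i // i ≠ i₀} → ℝ => f (chartPoint i₀ z)

/-- For `f` homogeneous of degree `-#ι`, the integral of `f Ω` over the simplex `σ(ℝ)` of the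
points of `ℙ(ℝ^ι)` with nonnegative projective coordinates, computed in the chart `A_{i₀} = 1`. -/
def simplexIntegral {ι : Type*} [Fintype ι] [DecidableEq ι] (i₀ : ι) (f : (ι → ℝ) → ℝ) : ℝ :=
  ∫ z in {z : {i // i ≠ i₀} → ℝ | ∀ i, 0 ≤ z i}, f (chartPoint i₀ z)

/-- Absolute convergence of `simplexIntegral`. -/
def SimplexIntegrable {ι : Type*} [Fintype ι] [DecidableEq ι] (i₀ : ι) (f : (ι → ℝ) → ℝ) : Prop :=
  IntegrableOn (fun z : {i // i ≠ i₀} → ℝ => f (chartPoint i₀ z)) {z | ∀ i, 0 ≤ z i}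

namespace OrientedGraph

variable {V E : Type*} [DecidableEq V] [Fintype E] {Γ : OrientedGraph V E} {n : ℕ}

/-- The coefficient `1 / ∏ q_e` of the form `ω_Γ = Ω_{4n-1}(Z) / (q_1 ⋯ q_{2n})`. -/
def quadricIntegrand (b : Module.Basis (Fin n) ℤ Γ.H1) (Z : Fin n × Fin 4 → ℝ) : ℝ :=
  1 / ∏ e : E, feynmanQuadric ℝ b e Z

/-- The period `P(Γ)`, the integral of `ω_Γ` over `ℙ^{4n-1}(ℝ)`, computed in the chart `j₀`. -/
def period (b : Module.Basis (Fin n) ℤ Γ.H1) (j₀ : Fin n × Fin 4) : ℝ :=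
  projectiveIntegral j₀ (quadricIntegrand b)

/-- The coefficient `1 / Ψ_Γ²` of the form `Ω_{2n-1}(A) / Ψ_Γ²`. -/
def schwingerIntegrand (b : Module.Basis (Fin n) ℤ Γ.H1) (A : E → ℝ) : ℝ :=
  1 / (MvPolynomial.aeval A (Γ.graphPolynomial b)) ^ 2

end OrientedGraph

end

/-!
The constant is `c = 1`, and both integrals are computed as integrals of nonnegative functions with
values in `[0, ∞]`, so that every exchange of integrals is Tonelli's theorem and absolute
convergence has to be checked only once, on the side of the graph polynomial.

**The identity.** Write `1 / ∏ q_e = ∫ exp (-∑ A_e q_e) dA` over the positive orthant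
(`lintegral_exp_neg_mul_prod`). A Lebesgue integral over `ℝ^ι` is the integral over an affine
chart of the integrals along the lines through the origin, `dZ = |s|^(#ι - 1) ds dz` for
`Z = s · (1, z)` (`lintegral_eq_lintegral_chart`). Applying this to `A`, with `#E = 2n`, leaves an
integral over the chart of the simplex and a radial integral of `t^(2n-1)` against the exponential
of `-t ∑ A_e q_e (1, z)`. The substitution `t = s²` turns `t^(2n-1) dt` into `|s|^(4n-1) ds`, which
together with `dz` is the Lebesgue measure of `H⁴`. So the two projective integrals are exchanged
without any Gamma factor (`lintegral_one_div_prod_chart`), and what is left is the Gaussian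
integral `∫ exp (-∑ A_e q_e) = π^(2n) / Ψ(A)²` (`lintegral_exp_neg_weighted_sum`).

**Convergence.** Go through the edges in order of decreasing `A_e`, and let `S` consist of the edges
whose coordinate function is independent of the previous ones (`exists_greedy_edges`). By
primitivity, `S` contains more than half of the first `k` edges for `0 < k < 2n`, and exactly half
of all of them. Summation by parts of `log A_e` gives
`(A_max / A_min) ∏ A_e ≤ (∏_{e ∈ S} A_e)²` (`exists_edges_prod_sq_ge`), and
`∏_{e ∈ S} A_e ≤ Ψ(A)` because the minor of `S` is a nonzero integer. The latter inequality is read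
off from Gaussian integrals, since dropping the edges outside `S` decreases the quadratic form
(`div_mul_prod_le_det_sq`). In the chart `A_{e₀} = 1` this bounds `1 / Ψ²` by a product of
integrable functions `min (a, 1/a)^δ / a` of one variable.
-/

/-! ### Matrices of the quadrics and the discriminant -/

namespace OrientedGraph

variable {V E : Type*} [DecidableEq V] [Fintype E] {Γ : OrientedGraph V E} {n : ℕ}

lemma edgeForm_apply (K : Type*) [CommRing K] (b : Module.Basis (Fin n) ℤ Γ.H1) (e : E)
    (x : Fin n → K) :
    edgeForm K b e x = ∑ i, (((b i : E → ℤ) e : ℤ) : K) * x i := by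
  simp [edgeForm]

lemma edgeForm_single (K : Type*) [CommRing K] (b : Module.Basis (Fin n) ℤ Γ.H1) (e : E)
    (i : Fin n) : edgeForm K b e (Pi.single i 1) = (((b i : E → ℤ) e : ℤ) : K) := by
  simp [edgeForm_apply, Pi.single_apply]

lemma edgeSquare_apply (K : Type*) [CommRing K] (b : Module.Basis (Fin n) ℤ Γ.H1) (e : E)
    (x : Fin n → K) : edgeSquare K b e x = edgeForm K b e x ^ 2 := by
  simp [edgeSquare, sq]

lemma feynmanQuadric_apply (K : Type*) [CommRing K] (b : Module.Basis (Fin n) ℤ Γ.H1) (e : E)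
    (Z : Fin n × Fin 4 → K) :
    feynmanQuadric K b e Z = ∑ a : Fin 4, edgeForm K b e (fun i => Z (i, a)) ^ 2 := by
  simp only [feynmanQuadric, sum_apply, QuadraticMap.comp_apply, edgeSquare_apply]
  rfl

lemma edgeSquare_toMatrix' (b : Module.Basis (Fin n) ℤ Γ.H1) (e : E) :
    (edgeSquare ℚ b e).toMatrix' =
      Matrix.of fun i j => (((b i : E → ℤ) e * (b j : E → ℤ) e : ℤ) : ℚ) := by
  ext i j
  simp only [QuadraticForm.toMatrix', LinearMap.toMatrix₂'_apply, QuadraticMap.associated_apply,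
    edgeSquare_apply, map_add, edgeForm_single, Matrix.of_apply, Module.End.smul_def,
    invOf_eq_inv, smul_eq_mul, QuadraticMap.half_moduleEnd_apply_eq_half_smul]
  push_cast
  ring

lemma feynmanQuadric_toMatrix' (b : Module.Basis (Fin n) ℤ Γ.H1) (e : E) :
    (feynmanQuadric ℚ b e).toMatrix' =
      Matrix.blockDiagonal fun _ : Fin 4 => (edgeSquare ℚ b e).toMatrix' := by
  ext ⟨i, a⟩ ⟨j, c⟩
  rw [edgeSquare_toMatrix']
  -- the summand `d` of a basis vector of `H⁴` is zero or a basis vector of `H`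
  have key : ∀ (i : Fin n) (a d : Fin 4), edgeForm ℚ b e
      (fun k => (Pi.single (i, a) 1 : Fin n × Fin 4 → ℚ) (k, d)) =
        if a = d then (((b i : E → ℤ) e : ℤ) : ℚ) else 0 := by
    intro i a d
    split_ifs with h
    · subst h
      simp [edgeForm_apply, Pi.single_apply, Prod.ext_iff]
    · simp [edgeForm_apply, Prod.ext_iff, Ne.symm h]
  have add : ∀ (x y : Fin n × Fin 4 → ℚ) (d : Fin 4),
      edgeForm ℚ b e (fun k => (x + y) (k, d)) =
        edgeForm ℚ b e (fun k => x (k, d)) + edgeForm ℚ b e (fun k => y (k, d)) :=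
    fun x y d => map_add _ _ _
  simp only [QuadraticForm.toMatrix', LinearMap.toMatrix₂'_apply, QuadraticMap.associated_apply,
    feynmanQuadric_apply, add, key, Matrix.blockDiagonal_apply, Matrix.of_apply,
    Module.End.smul_def, invOf_eq_inv, smul_eq_mul, QuadraticMap.half_moduleEnd_apply_eq_half_smul,
    ← Finset.sum_sub_distrib]
  have : ∀ (d : Fin 4) (u v : ℚ), ((if a = d then u else 0) + (if c = d then v else 0)) ^ 2 -
      (if a = d then u else 0) ^ 2 - (if c = d then v else 0) ^ 2 =
      if a = d then (if a = c then 2 * (u * v) else 0) else 0 := by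
    intro d u v
    by_cases h1 : a = d
    · subst h1
      by_cases h2 : c = a
      · simp only [h2, if_true]; ring
      · simp [h2, Ne.symm h2]
    · simp [h1]
  simp only [this, Finset.sum_ite_eq, Finset.mem_univ, if_true]
  split_ifs <;> simp

lemma graphPolynomial_map (b : Module.Basis (Fin n) ℤ Γ.H1) :
    (Γ.graphPolynomial b).map (Int.castRingHom ℚ) =
      discriminantPolynomial (fun e => (edgeSquare ℚ b e).toMatrix') := by
  rw [graphPolynomial, configurationPolynomial, discriminantPolynomial, RingHom.map_det]
  congr 1
  ext1 i j
  simp [Matrix.sum_apply, edgeSquare_toMatrix']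

lemma discriminantPolynomial_blockDiagonal {ι κ : Type*} [Fintype ι] [DecidableEq ι] [Fintype κ]
    [DecidableEq κ] (M : E → Matrix ι ι ℚ) :
    discriminantPolynomial (fun e => Matrix.blockDiagonal fun _ : κ => M e) =
      discriminantPolynomial M ^ Fintype.card κ := by
  have h : (∑ e : E, (MvPolynomial.X e : MvPolynomial E ℚ) •
      (Matrix.blockDiagonal fun _ : κ => M e).map (MvPolynomial.C (σ := E))) =
      Matrix.blockDiagonal fun _ : κ =>
        ∑ e : E, (MvPolynomial.X e : MvPolynomial E ℚ) •
          (M e).map (MvPolynomial.C (σ := E)) := by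
    ext1 ⟨i, a⟩ ⟨j, c⟩
    by_cases hac : a = c <;> simp [Matrix.sum_apply, Matrix.blockDiagonal_apply, hac]
  rw [discriminantPolynomial, discriminantPolynomial, h, Matrix.det_blockDiagonal]
  simp

/-- The matrix `(b_i(e))_{e,i}` over `ℝ` whose rows are the coordinate functions `ℓ_e`. -/
noncomputable def edgeMatrix (b : Module.Basis (Fin n) ℤ Γ.H1) : Matrix E (Fin n) ℝ :=
  Matrix.of fun e i => (((b i : E → ℤ) e : ℤ) : ℝ)

lemma edgeForm_eq_mulVec (b : Module.Basis (Fin n) ℤ Γ.H1) (e : E) (x : Fin n → ℝ) :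
    edgeForm ℝ b e x = (edgeMatrix b).mulVec x e := by
  simp [edgeForm_apply, edgeMatrix, Matrix.mulVec, dotProduct]

lemma aeval_graphPolynomial [DecidableEq E] (b : Module.Basis (Fin n) ℤ Γ.H1) (A : E → ℝ) :
    MvPolynomial.aeval A (Γ.graphPolynomial b) =
      ((edgeMatrix b).transpose * Matrix.diagonal A * edgeMatrix b).det := by
  rw [graphPolynomial, configurationPolynomial, AlgHom.map_det]
  congr 1
  ext i j
  simp only [AlgHom.mapMatrix_apply, Matrix.map_apply, Matrix.sum_apply, Matrix.smul_apply,
    Matrix.of_apply, smul_eq_mul, map_sum, map_mul, MvPolynomial.aeval_X, MvPolynomial.aeval_C,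
    Matrix.mul_apply (M := _ * _), Matrix.transpose_apply, Matrix.mul_diagonal, edgeMatrix]
  refine Finset.sum_congr rfl fun e _ => ?_
  simp
  ring

end OrientedGraph

/-! ### Integration along the lines through the origin -/

lemma continuous_chartPoint {ι : Type*} [DecidableEq ι] (i₀ : ι) :
    Continuous (chartPoint i₀) := by
  refine continuous_pi fun i => ?_
  by_cases h : i = i₀
  · simpa [chartPoint, h] using continuous_const
  · simpa [chartPoint, h] using continuous_apply _

lemma chartPoint_pos {ι : Type*} [DecidableEq ι] (i₀ : ι) {z : {i // i ≠ i₀} → ℝ}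
    (hz : ∀ i, 0 < z i) (i : ι) : 0 < chartPoint i₀ z i := by
  by_cases h : i = i₀
  · simp [chartPoint, h]
  · simpa [chartPoint, h] using hz _

lemma measurableSet_pos {ι : Type*} [Countable ι] : MeasurableSet {z : ι → ℝ | ∀ i, 0 < z i} := by
  have : {z : ι → ℝ | ∀ i, 0 < z i} = Set.univ.pi fun _ => Set.Ioi 0 := by
    ext; simp
  rw [this]
  exact MeasurableSet.univ_pi fun _ => measurableSet_Ioi

lemma lintegral_smul_ne_zero {ι : Type*} [Fintype ι] {s : ℝ} (hs : s ≠ 0)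
    (F : (ι → ℝ) → ENNReal) (hF : Measurable F) :
    ∫⁻ w, F w = ENNReal.ofReal (|s| ^ Fintype.card ι) * ∫⁻ z, F (s • z) := by
  have h := Measure.map_addHaar_smul (volume : Measure (ι → ℝ)) hs
  have h2 : ∫⁻ z, F (s • z) = ∫⁻ w, F w ∂(Measure.map (s • ·) volume) :=
    (lintegral_map hF (measurable_const_smul s)).symm
  rw [h2, h, lintegral_smul_measure, smul_eq_mul, ← mul_assoc, ← ENNReal.ofReal_mul (by positivity),
    Module.finrank_fintype_fun_eq_card, abs_inv, abs_pow, mul_inv_cancel₀ (by positivity)]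
  simp

/-- A Lebesgue integral on `ℝ^ι` in the coordinates `(s, z)` of the point `s · (1, z)`, where the
`1` stands at `i₀`. -/
lemma lintegral_eq_lintegral_chart {ι : Type*} [Fintype ι] [DecidableEq ι] (i₀ : ι)
    (F : (ι → ℝ) → ENNReal) (hF : Measurable F) :
    ∫⁻ Z, F Z = ∫⁻ s : ℝ, ENNReal.ofReal (|s| ^ (Fintype.card ι - 1)) *
      ∫⁻ z : {i // i ≠ i₀} → ℝ, F (s • chartPoint i₀ z) := by
  have e1 : MeasurePreserving
      (MeasurableEquiv.piEquivPiSubtypeProd (fun _ : ι => ℝ) (fun i => i = i₀)) volume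
      ((volume : Measure ({i // i = i₀} → ℝ)).prod (volume : Measure ({i // ¬ i = i₀} → ℝ))) := by
    convert! volume_preserving_piEquivPiSubtypeProd (fun _ : ι => ℝ) (fun i => i = i₀) using 3
    rw [Measure.volume_eq_prod]
    congr!
  have e2 : MeasurePreserving (MeasurableEquiv.funUnique {i // i = i₀} ℝ)
      (volume : Measure ({i // i = i₀} → ℝ)) (volume : Measure ℝ) := by
    convert! volume_preserving_funUnique {i // i = i₀} ℝ
  have e3 : MeasurePreserving _ _ (volume.prod (volume : Measure ({i // ¬ i = i₀} → ℝ))) :=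
    e2.prod (MeasurePreserving.id volume)
  have e := e3.comp e1
  let g : ℝ × ({i // i ≠ i₀} → ℝ) → (ι → ℝ) :=
    fun p i => if h : i = i₀ then p.1 else p.2 ⟨i, h⟩
  have hg : Measurable g := by
    refine measurable_pi_lambda _ fun i => ?_
    by_cases h : i = i₀
    · simpa [g, h] using measurable_fst
    · simp only [g, h, dite_false]
      exact (measurable_pi_apply _).comp measurable_snd
  have hcard : Fintype.card {i // i ≠ i₀} = Fintype.card ι - 1 := by
    simp [Fintype.card_subtype_compl]
  calc ∫⁻ Z, F Z = ∫⁻ p : ℝ × ({i // i ≠ i₀} → ℝ), F (g p) ∂(volume.prod volume) := by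
        refine Eq.trans ?_ (e.lintegral_comp (hF.comp hg))
        refine lintegral_congr fun Z => congrArg F ?_
        funext i
        by_cases h : i = i₀
        · subst h
          simp [g, MeasurableEquiv.piEquivPiSubtypeProd, Equiv.piEquivPiSubtypeProd]
          rfl
        · simp [g, h, MeasurableEquiv.piEquivPiSubtypeProd, Equiv.piEquivPiSubtypeProd]
    _ = ∫⁻ s : ℝ, ∫⁻ w, F (g (s, w)) := lintegral_prod _ (hF.comp hg).aemeasurable
    _ = _ := by
        refine lintegral_congr_ae ?_
        have h0 : ∀ᵐ s : ℝ, s ≠ 0 := by simp [ae_iff]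
        filter_upwards [h0] with s hs
        rw [lintegral_smul_ne_zero hs (fun w => F (g (s, w)))
          (hF.comp (hg.comp measurable_prodMk_left)), hcard]
        congr 1
        refine lintegral_congr fun z => congrArg F ?_
        funext i
        by_cases h : i = i₀ <;> simp [g, chartPoint, h]

/-! ### Gaussian integrals -/

lemma lintegral_exp_neg_sum_sq {ι : Type*} [Fintype ι] :
    ∫⁻ x : ι → ℝ, ENNReal.ofReal (Real.exp (-∑ i, x i ^ 2)) =
      ENNReal.ofReal (Real.sqrt Real.pi ^ Fintype.card ι) := by
  have h1 : Integrable fun x : ℝ => Real.exp (-x ^ 2) := by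
    simpa using integrable_exp_neg_mul_sq one_pos
  have h2 : ∫ x : ℝ, Real.exp (-x ^ 2) = Real.sqrt Real.pi := by
    simpa using integral_gaussian 1
  have h3 : ∀ x : ι → ℝ, Real.exp (-∑ i, x i ^ 2) = ∏ i, Real.exp (-x i ^ 2) := fun x => by
    rw [← Real.exp_sum, Finset.sum_neg_distrib]
  simp_rw [h3]
  rw [volume_pi, ← ofReal_integral_eq_lintegral_ofReal
    (Integrable.fintype_prod (f := fun (_ : ι) x => Real.exp (-x ^ 2)) fun _ => h1)
    (Filter.Eventually.of_forall fun x => by positivity),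
    ← volume_pi, integral_fintype_prod_volume_eq_pow (fun x : ℝ => Real.exp (-x ^ 2)), h2]

lemma lintegral_exp_neg_sum_mulVec_sq {ι : Type*} [Fintype ι] [DecidableEq ι] (C : Matrix ι ι ℝ)
    (hC : C.det ≠ 0) :
    ∫⁻ x : ι → ℝ, ENNReal.ofReal (Real.exp (-∑ i, C.mulVec x i ^ 2)) =
      ENNReal.ofReal (Real.sqrt Real.pi ^ Fintype.card ι / |C.det|) := by
  have h := Real.map_matrix_volume_pi_eq_smul_volume_pi hC
  have hm : Measurable fun x : ι → ℝ => ENNReal.ofReal (Real.exp (-∑ i, x i ^ 2)) := by fun_prop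
  have h2 : ∫⁻ x : ι → ℝ, ENNReal.ofReal (Real.exp (-∑ i, C.mulVec x i ^ 2)) =
      ∫⁻ y, ENNReal.ofReal (Real.exp (-∑ i, y i ^ 2)) ∂(Measure.map (Matrix.toLin' C) volume) :=
    (lintegral_map hm (Matrix.toLin' C).continuous_of_finiteDimensional.measurable).symm
  rw [h2, h, lintegral_smul_measure, lintegral_exp_neg_sum_sq, smul_eq_mul,
    ← ENNReal.ofReal_mul (by positivity), abs_inv]
  congr 1
  field_simp

/-- The exponent of `det C` is `4`, the number of copies of `ℝ^ι`. -/
lemma lintegral_exp_neg_sum_mulVec_sq_four {ι : Type*} [Fintype ι] [DecidableEq ι]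
    (C : Matrix ι ι ℝ) (hC : C.det ≠ 0) :
    ∫⁻ Z : ι × Fin 4 → ℝ,
        ENNReal.ofReal (Real.exp (-∑ a, ∑ i, C.mulVec (fun k => Z (k, a)) i ^ 2)) =
      ENNReal.ofReal (Real.pi ^ (2 * Fintype.card ι) / C.det ^ 4) := by
  have hd : (Matrix.blockDiagonal fun _ : Fin 4 => C).det = C.det ^ 4 := by
    simp [Matrix.det_blockDiagonal]
  have h := lintegral_exp_neg_sum_mulVec_sq (Matrix.blockDiagonal fun _ : Fin 4 => C)
    (by rw [hd]; exact pow_ne_zero _ hC)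
  rw [hd, abs_of_nonneg (by positivity), Fintype.card_prod, Fintype.card_fin,
    show Fintype.card ι * 4 = 2 * (2 * Fintype.card ι) by ring, pow_mul, Real.sq_sqrt
    Real.pi_pos.le] at h
  rw [← h]
  refine lintegral_congr fun Z => ?_
  rw [Fintype.sum_prod_type_right]
  have : ∀ a i, (Matrix.blockDiagonal fun _ : Fin 4 => C).mulVec Z (i, a) =
      C.mulVec (fun k => Z (k, a)) i := by
    intro a i
    simp [Matrix.mulVec, dotProduct, Fintype.sum_prod_type, Matrix.blockDiagonal_apply]
  simp_rw [this]

open scoped MatrixOrder in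
/-- The Gaussian integral of four copies of the form with matrix `Bᵀ diag(A) B`. That matrix is
symmetric positive definite, hence equal to `Cᵀ C` with `det C ^ 2 = det (Bᵀ diag(A) B)`. -/
lemma lintegral_exp_neg_weighted_sum {E ι : Type*} [Fintype E] [DecidableEq E] [Fintype ι]
    [DecidableEq ι] (B : Matrix E ι ℝ) (hB : Function.Injective B.mulVec) (A : E → ℝ)
    (hA : ∀ e, 0 < A e) :
    ∫⁻ Z : ι × Fin 4 → ℝ,
        ENNReal.ofReal (Real.exp (-∑ e, A e * ∑ a, B.mulVec (fun k => Z (k, a)) e ^ 2)) =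
      ENNReal.ofReal (Real.pi ^ (2 * Fintype.card ι) /
        (B.transpose * Matrix.diagonal A * B).det ^ 2) ∧
      0 < (B.transpose * Matrix.diagonal A * B).det := by
  set M := B.transpose * Matrix.diagonal A * B with hM
  have hpos : M.PosDef := by
    have := (Matrix.PosDef.diagonal hA).conjTranspose_mul_mul_same hB
    simpa [hM, Matrix.conjTranspose_eq_transpose_of_trivial] using this
  obtain ⟨C, hC⟩ : ∃ C : Matrix ι ι ℝ, M = C.transpose * C := by
    obtain ⟨C, hC⟩ := CStarAlgebra.nonneg_iff_eq_star_mul_self.mp hpos.posSemidef.nonneg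
    exact ⟨C, by simpa [Matrix.star_eq_conjTranspose,
      Matrix.conjTranspose_eq_transpose_of_trivial] using hC⟩
  have hdet : M.det = C.det ^ 2 := by rw [hC, Matrix.det_mul, Matrix.det_transpose, sq]
  have hC0 : C.det ≠ 0 := fun h => hpos.det_pos.ne' (by rw [hdet, h]; simp)
  refine ⟨?_, hpos.det_pos⟩
  rw [hdet, ← pow_mul, ← lintegral_exp_neg_sum_mulVec_sq_four C hC0]
  refine lintegral_congr fun Z => ?_
  have hq : ∀ x : ι → ℝ, ∑ e, A e * B.mulVec x e ^ 2 = ∑ i, C.mulVec x i ^ 2 := by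
    intro x
    have h1 : x ⬝ᵥ (M.mulVec x) = ∑ e, A e * B.mulVec x e ^ 2 := by
      rw [hM, ← Matrix.mulVec_mulVec, ← Matrix.mulVec_mulVec, Matrix.dotProduct_mulVec,
        Matrix.vecMul_transpose]
      simp only [dotProduct, Matrix.mulVec_diagonal]
      exact Finset.sum_congr rfl fun e _ => by ring
    have h2 : x ⬝ᵥ (M.mulVec x) = ∑ i, C.mulVec x i ^ 2 := by
      rw [hC, ← Matrix.mulVec_mulVec, Matrix.dotProduct_mulVec, Matrix.vecMul_transpose]
      simp only [dotProduct]
      exact Finset.sum_congr rfl fun e _ => by ring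
    rw [← h1, h2]
  congr 3
  simp_rw [← hq, Finset.mul_sum]
  exact Finset.sum_comm

/-! ### The parametric form of a product of reciprocals -/

lemma lintegral_eq_two_mul_of_even (g : ℝ → ENNReal) (hg : ∀ s, g (-s) = g s) :
    ∫⁻ s, g s = 2 * ∫⁻ s in Set.Ioi 0, g s := by
  rw [← lintegral_add_compl g measurableSet_Ioi (A := Set.Ioi (0 : ℝ)), two_mul, Set.compl_Ioi,
    ← restrict_Iio_eq_restrict_Iic]
  congr 1
  have := (Measure.measurePreserving_neg (volume : Measure ℝ)).setLIntegral_comp_preimage_emb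
    (MeasurableEquiv.neg ℝ).measurableEmbedding g (Set.Ioi 0)
  simpa [hg] using this

/-- The substitution `t = s²`, the right-hand side being even in `s`. -/
lemma lintegral_Ioi_pow_eq_lintegral_sq (m : ℕ) (hm : 1 ≤ m) (g : ℝ → ENNReal) :
    ∫⁻ t in Set.Ioi (0 : ℝ), ENNReal.ofReal (t ^ (m - 1)) * g t =
      ∫⁻ s : ℝ, ENNReal.ofReal (|s| ^ (2 * m - 1)) * g (s ^ 2) := by
  have himg : (fun s : ℝ => s ^ 2) '' Set.Ioi 0 = Set.Ioi 0 := by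
    ext t
    constructor
    · rintro ⟨s, hs, rfl⟩
      exact pow_pos (Set.mem_Ioi.mp hs) 2
    · intro ht
      exact ⟨Real.sqrt t, Real.sqrt_pos.mpr ht, Real.sq_sqrt (le_of_lt ht)⟩
  have hinj : Set.InjOn (fun s : ℝ => s ^ 2) (Set.Ioi 0) := fun x hx y hy h =>
    (pow_left_inj₀ (le_of_lt hx) (le_of_lt hy) two_ne_zero).mp h
  have h := lintegral_image_eq_lintegral_abs_deriv_mul (f' := fun s : ℝ => 2 * s)
    measurableSet_Ioi
    (fun x _ => by simpa using (hasDerivAt_pow 2 x).hasDerivWithinAt (s := Set.Ioi (0 : ℝ))) hinj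
    (fun t => ENNReal.ofReal (t ^ (m - 1)) * g t)
  rw [himg] at h
  rw [h, lintegral_eq_two_mul_of_even _ (fun s => by simp),
    ← lintegral_const_mul' _ _ (by simp)]
  refine setLIntegral_congr_fun measurableSet_Ioi fun s (hs : 0 < s) => ?_
  have : |2 * s| * (s ^ 2) ^ (m - 1) = 2 * |s| ^ (2 * m - 1) := by
    rw [abs_of_pos hs, abs_of_pos (by positivity), ← pow_mul,
      show 2 * m - 1 = 2 * (m - 1) + 1 by omega, pow_succ]
    ring
  rw [← mul_assoc, ← mul_assoc, ← ENNReal.ofReal_mul (by positivity), this,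
    ENNReal.ofReal_mul (by norm_num)]
  simp

/-- The product over `e` of `1 / q = ∫ exp (-a q) da` over `a > 0`. -/
lemma lintegral_exp_neg_mul_prod {E : Type*} [Fintype E] (q : E → ℝ) (hq : ∀ e, 0 < q e) :
    ∫⁻ A : E → ℝ in {A | ∀ e, 0 < A e}, ENNReal.ofReal (Real.exp (-∑ e, A e * q e)) =
      ENNReal.ofReal (1 / ∏ e, q e) := by
  have hset : {A : E → ℝ | ∀ e, 0 < A e} = Set.univ.pi fun _ => Set.Ioi 0 := by
    ext; simp
  have hvol : (volume : Measure (E → ℝ)).restrict {A | ∀ e, 0 < A e} =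
      Measure.pi fun _ => volume.restrict (Set.Ioi (0 : ℝ)) := by
    rw [hset, volume_pi, Measure.restrict_pi_pi]
  have hint : ∀ e, Integrable (fun a : ℝ => Real.exp (-(a * q e)))
      (volume.restrict (Set.Ioi (0 : ℝ))) := fun e => by
    have := integrableOn_exp_mul_Ioi (a := -q e) (by linarith [hq e]) 0
    refine this.congr_fun (fun x _ => ?_) measurableSet_Ioi
    simp only []; congr 1; ring
  have hval : ∀ e, ∫ a in Set.Ioi (0 : ℝ), Real.exp (-(a * q e)) = 1 / q e := fun e => by
    have := integral_exp_mul_Ioi (a := -q e) (by linarith [hq e]) 0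
    rw [show (fun a : ℝ => Real.exp (-(a * q e))) = fun x => Real.exp (-q e * x) from
      funext fun x => by congr 1; ring, this]
    simp [neg_div_neg_eq]
  have hprod : ∀ A : E → ℝ, Real.exp (-∑ e, A e * q e) = ∏ e, Real.exp (-(A e * q e)) :=
    fun A => by rw [← Real.exp_sum, Finset.sum_neg_distrib]
  simp_rw [hprod]
  rw [hvol, ← ofReal_integral_eq_lintegral_ofReal (Integrable.fintype_prod_dep hint)
    (Filter.Eventually.of_forall fun x => by positivity),
    integral_fintype_prod_eq_prod (fun e (a : ℝ) => Real.exp (-(a * q e)))]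
  simp [hval]

/-- The version of `lintegral_eq_lintegral_chart` for the positive orthant. -/
lemma setLIntegral_pos_eq_lintegral_chart {ι : Type*} [Fintype ι] [DecidableEq ι] (i₀ : ι)
    (F : (ι → ℝ) → ENNReal) (hF : Measurable F) :
    ∫⁻ A in {A : ι → ℝ | ∀ i, 0 < A i}, F A =
      ∫⁻ a in {a : {i // i ≠ i₀} → ℝ | ∀ i, 0 < a i},
        ∫⁻ s in Set.Ioi (0 : ℝ), ENNReal.ofReal (s ^ (Fintype.card ι - 1)) *
          F (s • chartPoint i₀ a) := by
  have hmeas : Measurable fun p : ℝ × ({i // i ≠ i₀} → ℝ) => F (p.1 • chartPoint i₀ p.2) :=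
    hF.comp (Continuous.measurable
      (continuous_fst.smul ((continuous_chartPoint i₀).comp continuous_snd)))
  have hmeas' : Measurable fun p : ℝ × ({i // i ≠ i₀} → ℝ) =>
      ENNReal.ofReal (p.1 ^ (Fintype.card ι - 1)) * F (p.1 • chartPoint i₀ p.2) :=
    (ENNReal.measurable_ofReal.comp (measurable_fst.pow_const _)).mul hmeas
  have hiff : ∀ (s : ℝ) (a : {i // i ≠ i₀} → ℝ), 0 < s →
      ((s • chartPoint i₀ a) ∈ {A : ι → ℝ | ∀ i, 0 < A i} ↔ a ∈ {a | ∀ i, 0 < a i}) := by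
    intro s a hs
    constructor
    · intro h i
      have := h i
      simpa [chartPoint, i.2, hs] using this
    · intro h i
      exact mul_pos hs (chartPoint_pos i₀ h i)
  rw [← lintegral_indicator measurableSet_pos,
    lintegral_eq_lintegral_chart i₀ _ (hF.indicator measurableSet_pos),
    ← lintegral_lintegral_swap hmeas'.aemeasurable, ← lintegral_indicator measurableSet_Ioi]
  refine lintegral_congr fun s => ?_
  by_cases hs : 0 < s
  · rw [Set.indicator_of_mem (Set.mem_Ioi.mpr hs), abs_of_pos hs,
      lintegral_const_mul' _ _ ENNReal.ofReal_ne_top, ← lintegral_indicator measurableSet_pos]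
    congr 1
    refine lintegral_congr fun a => ?_
    by_cases ha : a ∈ {a : {i // i ≠ i₀} → ℝ | ∀ i, 0 < a i}
    · rw [Set.indicator_of_mem ha, Set.indicator_of_mem ((hiff s a hs).mpr ha)]
    · rw [Set.indicator_of_notMem ha, Set.indicator_of_notMem ((hiff s a hs).not.mpr ha)]
  · rw [Set.indicator_of_notMem (by simpa using hs)]
    have : ∀ a, Set.indicator {A : ι → ℝ | ∀ i, 0 < A i} F (s • chartPoint i₀ a) = 0 := by
      intro a
      refine Set.indicator_of_notMem (fun h => hs ?_) _
      simpa [chartPoint] using h i₀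
    simp [this]

/-- The exchange of the two projective integrals, for quadratic `q e` on a space of dimension twice
their number: both sides are the integral of `exp (-∑ A_e q_e (1, z))` over all positive `A` and
all `z`. -/
lemma lintegral_one_div_prod_chart {E ι : Type*} [Fintype E] [DecidableEq E] [Fintype ι]
    [DecidableEq ι] (q : E → (ι → ℝ) → ℝ) (hq : ∀ e, Continuous (q e))
    (hhom : ∀ e (s : ℝ) Z, q e (s • Z) = s ^ 2 * q e Z)
    (hcard : Fintype.card ι = 2 * Fintype.card E) (j₀ : ι) (e₀ : E)
    (hpos : ∀ᵐ z, ∀ e, 0 < q e (chartPoint j₀ z)) :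
    ∫⁻ z, ENNReal.ofReal (1 / ∏ e, q e (chartPoint j₀ z)) =
      ∫⁻ a in {a : {e // e ≠ e₀} → ℝ | ∀ e, 0 < a e},
        ∫⁻ Z, ENNReal.ofReal (Real.exp (-∑ e, chartPoint e₀ a e * q e Z)) := by
  have hc := continuous_chartPoint j₀
  have hG : Measurable fun p : (E → ℝ) × ({j // j ≠ j₀} → ℝ) =>
      ENNReal.ofReal (Real.exp (-∑ e, p.1 e * q e (chartPoint j₀ p.2))) := by
    refine ENNReal.measurable_ofReal.comp (Continuous.measurable ?_)
    fun_prop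
  have hexp : ∀ A : E → ℝ, Measurable fun Z : ι → ℝ =>
      ENNReal.ofReal (Real.exp (-∑ e, A e * q e Z)) := by
    intro A
    refine ENNReal.measurable_ofReal.comp (Continuous.measurable ?_)
    fun_prop
  calc ∫⁻ z, ENNReal.ofReal (1 / ∏ e, q e (chartPoint j₀ z))
      = ∫⁻ z, ∫⁻ A : E → ℝ in {A | ∀ e, 0 < A e},
          ENNReal.ofReal (Real.exp (-∑ e, A e * q e (chartPoint j₀ z))) := by
        refine lintegral_congr_ae ?_
        filter_upwards [hpos] with z hz
        exact (lintegral_exp_neg_mul_prod _ hz).symm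
    _ = ∫⁻ A : E → ℝ in {A | ∀ e, 0 < A e}, ∫⁻ z,
          ENNReal.ofReal (Real.exp (-∑ e, A e * q e (chartPoint j₀ z))) :=
        (lintegral_lintegral_swap hG.aemeasurable).symm
    _ = _ := by
        -- the radial variable of `A` becomes the square of the radial variable of `Z`
        rw [setLIntegral_pos_eq_lintegral_chart e₀ _ hG.lintegral_prod_right']
        refine lintegral_congr fun a => ?_
        rw [lintegral_Ioi_pow_eq_lintegral_sq _ (Fintype.card_pos_iff.mpr ⟨e₀⟩)
          (fun s => ∫⁻ z, ENNReal.ofReal (Real.exp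
            (-∑ e, (s • chartPoint e₀ a) e * q e (chartPoint j₀ z)))), ← hcard,
          lintegral_eq_lintegral_chart j₀ _ (hexp _)]
        refine lintegral_congr fun s => ?_
        congr 1
        refine lintegral_congr fun z => ?_
        congr 3
        refine Finset.sum_congr rfl fun e _ => ?_
        rw [hhom, Pi.smul_apply, smul_eq_mul]
        ring

/-! ### Greedy choice of a maximal minor -/

/-- Summation by parts for a decreasing sequence `x`: the partial sums of `d` dominate those of
`1, 0, …, 0, -1`. -/
lemma sub_le_sum_mul_of_one_le_partial_sums {N : ℕ} (hN : 1 ≤ N) (x d : ℕ → ℝ)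
    (hx : ∀ i, i + 1 < N → x (i + 1) ≤ x i)
    (hd : ∀ k, 0 < k → k < N → 1 ≤ ∑ i ∈ Finset.range k, d i)
    (hdN : ∑ i ∈ Finset.range N, d i = 0) :
    x 0 - x (N - 1) ≤ ∑ i ∈ Finset.range N, x i * d i := by
  have h := Finset.sum_range_by_parts x d N
  simp only [smul_eq_mul, hdN, mul_zero, zero_sub] at h
  rw [h, ← Finset.sum_range_sub', ← Finset.sum_neg_distrib]
  refine Finset.sum_le_sum fun i hi => ?_
  have hi := Finset.mem_range.mp hi
  nlinarith [hx i (by omega), hd (i + 1) (by omega) (by omega)]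

namespace OrientedGraph

variable {V E : Type*} [DecidableEq V] [Fintype E] {Γ : OrientedGraph V E} {n : ℕ}

/-- The cycles which vanish on the edges in `T`. -/
def cyclesVanishingOn (Γ : OrientedGraph V E) (T : Set E) : Submodule ℤ Γ.H1 where
  carrier := {h | ∀ e ∈ T, (h : E → ℤ) e = 0}
  add_mem' {g h} hg hh e he := by simp [hg e he, hh e he]
  zero_mem' e _ := by simp
  smul_mem' c h hh e he := by simp [hh e he]

lemma mem_H1 {h : E → ℤ} : h ∈ Γ.H1 ↔ ∀ v, ∑ e, Γ.sign v e * h e = 0 := by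
  rw [H1, LinearMap.mem_ker, funext_iff]
  simp [boundary, Matrix.mulVec, dotProduct]

/-- Cycles of `Γ` vanishing off `F` are cycles of the subgraph with edge set `F`. -/
lemma finrank_cyclesVanishingOn_compl_le (F : Finset E) :
    Module.finrank ℤ (Γ.cyclesVanishingOn {e | e ∉ F}) ≤ (Γ.restrict F).loopNumber := by
  let f : Γ.cyclesVanishingOn {e | e ∉ F} →ₗ[ℤ] (Γ.restrict F).H1 :=
    { toFun := fun h => ⟨fun e => (h : Γ.H1).1 e, by
        rw [mem_H1]
        intro v
        have h1 := mem_H1.mp (h : Γ.H1).2 v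
        rw [← h1]
        have h2 : ∀ e ∈ Finset.univ, e ∉ F → Γ.sign v e * (h : Γ.H1).1 e = 0 :=
          fun e _ he => by rw [h.2 e he, mul_zero]
        rw [← Finset.sum_subset (Finset.subset_univ F) h2,
          ← Finset.sum_coe_sort F fun e => Γ.sign v e * (h : Γ.H1).1 e]
        rfl⟩
      map_add' := fun g h => rfl
      map_smul' := fun c h => rfl }
  refine LinearMap.finrank_le_finrank_of_injective (f := f) fun g h hgh => ?_
  ext e
  by_cases he : e ∈ F
  · exact congrFun (congrArg Subtype.val hgh) ⟨e, he⟩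
  · rw [g.2 e he, h.2 e he]

/-- Imposing the vanishing at one more edge lowers the rank by one, unless it is automatic. -/
lemma finrank_cyclesVanishingOn_insert (T : Set E) (e : E) :
    (Module.finrank ℤ (Γ.cyclesVanishingOn (insert e T)) =
        Module.finrank ℤ (Γ.cyclesVanishingOn T) ∧
      ∀ h ∈ Γ.cyclesVanishingOn T, (h : E → ℤ) e = 0) ∨
    (Module.finrank ℤ (Γ.cyclesVanishingOn (insert e T)) + 1 =
        Module.finrank ℤ (Γ.cyclesVanishingOn T) ∧
      ∃ h ∈ Γ.cyclesVanishingOn T, (h : E → ℤ) e ≠ 0) := by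
  let f : Γ.cyclesVanishingOn T →ₗ[ℤ] ℤ :=
    LinearMap.proj e ∘ₗ Γ.H1.subtype ∘ₗ (Γ.cyclesVanishingOn T).subtype
  have hf : ∀ h, f h = (h : Γ.H1).1 e := fun h => rfl
  have hle : Γ.cyclesVanishingOn (insert e T) ≤ Γ.cyclesVanishingOn T :=
    fun h hh e' he' => hh e' (Or.inr he')
  have hker : (LinearMap.ker f).map (Γ.cyclesVanishingOn T).subtype =
      Γ.cyclesVanishingOn (insert e T) := by
    ext h
    constructor
    · rintro ⟨g, hg, rfl⟩ e' (rfl | he')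
      · exact hg
      · exact g.2 e' he'
    · intro hh
      exact ⟨⟨h, hle hh⟩, hh e (Or.inl rfl), rfl⟩
  have hfk : Module.finrank ℤ (LinearMap.ker f) =
      Module.finrank ℤ (Γ.cyclesVanishingOn (insert e T)) := by
    rw [← hker]
    exact (Submodule.equivMapOfInjective _ (Submodule.injective_subtype _) _).finrank_eq
  by_cases hz : ∀ h ∈ Γ.cyclesVanishingOn T, (h : E → ℤ) e = 0
  · left
    refine ⟨?_, hz⟩
    rw [le_antisymm hle fun h hh e' he' => ?_]
    rcases he' with rfl | he'
    · exact hz h hh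
    · exact hh e' he'
  · right
    push Not at hz
    refine ⟨?_, hz⟩
    obtain ⟨h, hh, hne⟩ := hz
    have hrn := (LinearMap.ker f).finrank_quotient_add_finrank
    rw [hfk, f.quotKerEquivRange.finrank_eq] at hrn
    have hrange : Module.finrank ℤ (LinearMap.range f) = 1 := by
      refine le_antisymm ?_ ?_
      · simpa using Submodule.finrank_le (LinearMap.range f)
      · rw [Nat.one_le_iff_ne_zero, Ne, Submodule.finrank_eq_zero, LinearMap.range_eq_bot]
        intro h0
        exact hne (by simpa [h0] using (hf ⟨h, hh⟩).symm)
    omega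

/-- Order the edges by `σ` and let `S` be the set of those whose coordinate function does not vanish
on the cycles vanishing on all previous edges. For each `k`, the number of elements of `S` among
the first `k` edges is the corank of the lattice of cycles vanishing on these edges. That lattice
consists of cycles of the subgraph formed by the remaining edges, so that primitivity makes this
number larger than `k / 2`. -/
lemma exists_greedy_edges (hΓ : Γ.IsPrimitiveLogDivergent) {N : ℕ} (σ : Fin N ≃ E) :
    ∃ S : Finset E, S.card = Γ.loopNumber ∧
      (∀ h ∈ Γ.H1, (∀ e ∈ S, h e = 0) → h = 0) ∧
      ∀ k, 0 < k → k < N → k + 1 ≤ 2 * (S.filter fun e => (σ.symm e : ℕ) < k).card := by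
  classical
  set T : ℕ → Set E := fun k => {e | (σ.symm e : ℕ) < k} with hT
  have hTs : ∀ k (hk : k < N), T (k + 1) = insert (σ ⟨k, hk⟩) (T k) := by
    intro k hk
    ext e
    simp only [hT, Set.mem_ofPred_eq, Set.mem_insert_iff, ← σ.symm_apply_eq, Fin.ext_iff]
    omega
  set S : Finset E := Finset.univ.filter fun e =>
    ∃ h ∈ Γ.cyclesVanishingOn (T (σ.symm e)), (h : E → ℤ) e ≠ 0 with hS
  have hfilter : ∀ k (hk : k < N), (S.filter fun e => (σ.symm e : ℕ) < k + 1) =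
      if σ ⟨k, hk⟩ ∈ S then insert (σ ⟨k, hk⟩) (S.filter fun e => (σ.symm e : ℕ) < k)
      else S.filter fun e => (σ.symm e : ℕ) < k := by
    intro k hk
    have hiff : ∀ e, e = σ ⟨k, hk⟩ ↔ (σ.symm e : ℕ) = k := fun e => by
      rw [← σ.symm_apply_eq, Fin.ext_iff]
    ext e
    split_ifs with hmem
    · simp only [Finset.mem_filter, Finset.mem_insert]
      by_cases he : e = σ ⟨k, hk⟩
      · simp [he, hmem]
      · have := (hiff e).not.mp he
        simp only [he, false_or]
        refine and_congr_right fun _ => ?_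
        omega
    · simp only [Finset.mem_filter]
      refine and_congr_right fun heS => ?_
      have he : e ≠ σ ⟨k, hk⟩ := fun h => hmem (h ▸ heS)
      have := (hiff e).not.mp he
      omega
  have hmemS : ∀ k (hk : k < N), σ ⟨k, hk⟩ ∈ S ↔
      ∃ h ∈ Γ.cyclesVanishingOn (T k), (h : E → ℤ) (σ ⟨k, hk⟩) ≠ 0 := by
    intro k hk
    simp [hS]
  have hcount : ∀ k, k ≤ N → Module.finrank ℤ (Γ.cyclesVanishingOn (T k)) +
      (S.filter fun e => (σ.symm e : ℕ) < k).card = Γ.loopNumber := by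
    intro k
    induction k with
    | zero =>
      intro _
      have : Γ.cyclesVanishingOn (T 0) = ⊤ := by
        refine eq_top_iff.mpr fun h _ e he => ?_
        simp [hT] at he
      rw [this, finrank_top, loopNumber]
      simp
    | succ k ih =>
      intro hk
      have ih := ih (by omega)
      rw [hTs k hk, hfilter k hk]
      rcases finrank_cyclesVanishingOn_insert (Γ := Γ) (T k) (σ ⟨k, hk⟩) with ⟨h1, h2⟩ | ⟨h1, h2⟩
      · rw [if_neg, h1, ih]
        rw [hmemS]
        push Not
        exact h2
      · rw [if_pos ((hmemS k hk).mpr h2), Finset.card_insert_of_notMem (by simp)]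
        omega
  have hTN : T N = Set.univ := by
    ext e; simp [hT]
  have hzero : Γ.cyclesVanishingOn (T N) = ⊥ := by
    refine eq_bot_iff.mpr fun h hh => ?_
    rw [hTN] at hh
    rw [Submodule.mem_bot]
    ext e
    exact hh e trivial
  refine ⟨S, ?_, ?_, ?_⟩
  · have := hcount N le_rfl
    rw [hzero, finrank_bot, zero_add] at this
    rw [← this]
    congr 1
    ext e
    simp
  · intro h hh hS0
    have key : ∀ k, k ≤ N → (⟨h, hh⟩ : Γ.H1) ∈ Γ.cyclesVanishingOn (T k) := by
      intro k
      induction k with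
      | zero => intro _ e he; simp [hT] at he
      | succ k ih =>
        intro hk e he
        have ih := ih (by omega)
        rw [hTs k hk] at he
        rcases he with rfl | he
        · by_contra hne
          exact hne (hS0 _ ((hmemS k hk).mpr ⟨_, ih, hne⟩))
        · exact ih e he
    have := key N le_rfl
    rw [hzero, Submodule.mem_bot] at this
    exact congrArg Subtype.val this
  · intro k hk0 hkN
    have hcard : Fintype.card E = N := by rw [← Fintype.card_congr σ, Fintype.card_fin]
    -- the edges from position `k` on form a proper subgraph
    set F : Finset E := Finset.univ.filter fun e => ¬ (σ.symm e : ℕ) < k with hF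
    have hFT : {e | e ∉ F} = T k := by ext e; simp [hF, hT]
    have hFc : F.card = N - k := by
      rw [hF, ← Finset.card_map σ.symm.toEmbedding]
      have : Finset.map σ.symm.toEmbedding (Finset.univ.filter fun e => ¬ (σ.symm e : ℕ) < k) =
          Finset.Ici (⟨k, hkN⟩ : Fin N) := by
        ext i
        simp [Fin.le_def]
      rw [this, Fin.card_Ici]
    have hconv := hΓ.2 F (Finset.card_pos.mp (by omega)) (fun h => by
      have := congrArg Finset.card h
      rw [hFc, Finset.card_univ] at this
      omega)
    have h1 := finrank_cyclesVanishingOn_compl_le (Γ := Γ) F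
    rw [hFT] at h1
    have h2 := hcount k hkN.le
    have h3 := hΓ.1
    rw [IsConvergent, Fintype.card_coe, hFc] at hconv
    rw [IsLogDivergent, hcard] at h3
    omega

/-- The greedy choice for the order of decreasing `A`. The weight of `log (A e)` in
`2 log ∏_S A - log ∏ A` is `1` for `e ∈ S` and `-1` otherwise; all proper partial sums of these
weights are positive and the total sum is `0`. -/
lemma exists_edges_prod_sq_ge (hΓ : Γ.IsPrimitiveLogDivergent) (A : E → ℝ) (hA : ∀ e, 0 < A e) :
    ∃ S : Finset E, S.card = Γ.loopNumber ∧
      (∀ h ∈ Γ.H1, (∀ e ∈ S, h e = 0) → h = 0) ∧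
      ∀ e f, A e / A f * ∏ g, A g ≤ (∏ g ∈ S, A g) ^ 2 := by
  classical
  rcases isEmpty_or_nonempty E with hE | hE
  · refine ⟨∅, ?_, fun h _ _ => funext fun e => hE.elim e, fun e => hE.elim e⟩
    have := hΓ.1
    rw [IsLogDivergent, Fintype.card_eq_zero] at this
    simp only [Finset.card_empty]
    omega
  obtain ⟨N, hN⟩ : ∃ N, Fintype.card E = N := ⟨_, rfl⟩
  have hN1 : 1 ≤ N := hN ▸ Fintype.card_pos
  obtain ⟨σ, hσ⟩ : ∃ σ : Fin N ≃ E, Antitone (A ∘ σ) := by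
    let τ := (Fintype.equivFinOfCardEq hN).symm
    refine ⟨(Tuple.sort fun i => - A (τ i)).trans τ, fun i j hij => ?_⟩
    have := Tuple.monotone_sort (fun i => - A (τ i)) hij
    simpa using this
  obtain ⟨S, hS1, hS2, hS3⟩ := exists_greedy_edges hΓ σ
  refine ⟨S, hS1, hS2, fun e f => ?_⟩
  -- the logarithms of the `A e` in decreasing order, and their weights
  let x : ℕ → ℝ := fun k => if h : k < N then Real.log (A (σ ⟨k, h⟩)) else 0
  let d : ℕ → ℝ := fun k => if h : k < N then (if σ ⟨k, h⟩ ∈ S then 2 else 0) - 1 else 0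
  have hd : ∀ k, k ≤ N → ∑ i ∈ Finset.range k, d i =
      2 * ((S.filter fun e => (σ.symm e : ℕ) < k).card : ℝ) - k := by
    intro k hk
    have h1 : ∀ i ∈ Finset.range k, d i =
        2 * (if ∃ h : i < N, σ ⟨i, h⟩ ∈ S then 1 else 0) - 1 := by
      intro i hi
      have hi' : i < N := (Finset.mem_range.mp hi).trans_le hk
      simp [d, hi']
    rw [Finset.sum_congr rfl h1, Finset.sum_sub_distrib, ← Finset.mul_sum, Finset.sum_boole]
    simp only [Finset.sum_const, Finset.card_range, nsmul_eq_mul, mul_one]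
    congr 3
    refine Finset.card_bij' (fun i hi => σ ⟨i, by
        simp only [Finset.mem_filter] at hi; exact hi.2.1⟩) (fun e _ => (σ.symm e : ℕ)) ?_ ?_ ?_ ?_
    · intro i hi
      simp only [Finset.mem_filter, Finset.mem_range] at hi ⊢
      exact ⟨hi.2.2, by simpa using hi.1⟩
    · intro e he
      simp only [Finset.mem_filter, Finset.mem_range] at he ⊢
      exact ⟨he.2, (σ.symm e).2, by simpa using he.1⟩
    · intro i _; simp
    · intro e _; simp
  have habel := sub_le_sum_mul_of_one_le_partial_sums hN1 x d
    (by
      intro i hi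
      have hi' : i < N := by omega
      simp only [x, hi, hi', dif_pos]
      exact Real.log_le_log (hA _) (hσ (Fin.mk_le_mk.mpr (Nat.le_succ i))))
    (by
      intro k hk0 hkN
      rw [hd k hkN.le]
      have := hS3 k hk0 hkN
      have : ((k + 1 : ℕ) : ℝ) ≤
        ((2 * (S.filter fun e => (σ.symm e : ℕ) < k).card : ℕ) : ℝ) := by exact_mod_cast this
      push_cast at this
      linarith)
    (by
      rw [hd N le_rfl]
      have h1 : (S.filter fun e => (σ.symm e : ℕ) < N) = S := by ext; simp
      have h2 : N = 2 * S.card := by rw [hS1, ← hN]; exact hΓ.1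
      rw [h1, sub_eq_zero]
      exact_mod_cast h2.symm)
  have hsum : ∑ i ∈ Finset.range N, x i * d i =
      2 * ∑ g ∈ S, Real.log (A g) - ∑ g, Real.log (A g) := by
    have h1 : ∑ i ∈ Finset.range N, x i * d i =
        ∑ g, Real.log (A g) * ((if g ∈ S then 2 else 0) - 1) := by
      rw [Finset.sum_range, ← Equiv.sum_comp σ]
      exact Finset.sum_congr rfl fun i _ => by simp [x, d]
    rw [h1]
    simp only [mul_sub, mul_ite, mul_zero, mul_one, Finset.sum_sub_distrib, Finset.sum_ite_mem,
      Finset.univ_inter, ← Finset.sum_mul]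
    ring
  have hx0 : Real.log (A e) ≤ x 0 := by
    have h0 : x 0 = Real.log (A (σ ⟨0, hN1⟩)) := dif_pos hN1
    rw [h0]
    refine Real.log_le_log (hA e) ?_
    simpa using hσ (show (⟨0, hN1⟩ : Fin N) ≤ σ.symm e from Nat.zero_le _)
  have hxN : x (N - 1) ≤ Real.log (A f) := by
    have h0 : x (N - 1) = Real.log (A (σ ⟨N - 1, by omega⟩)) := dif_pos (by omega)
    rw [h0]
    refine Real.log_le_log (hA _) ?_
    have h1 : σ.symm f ≤ (⟨N - 1, by omega⟩ : Fin N) := Nat.le_sub_one_of_lt (σ.symm f).2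
    simpa using hσ h1
  have hprod : ∀ s : Finset E, 0 < ∏ g ∈ s, A g := fun s => Finset.prod_pos fun g _ => hA g
  have hef : 0 < A e / A f := div_pos (hA e) (hA f)
  rw [← Real.log_le_log_iff (mul_pos hef (hprod _)) (pow_pos (hprod S) 2),
    Real.log_mul hef.ne' (hprod _).ne', Real.log_div (hA e).ne' (hA f).ne', Real.log_pow,
    Real.log_prod fun g _ => (hA g).ne', Real.log_prod fun g _ => (hA g).ne']
  push_cast
  linarith

/-- The minor is a nonzero integer. -/
lemma one_le_det_edgeMatrix_submatrix_sq (b : Module.Basis (Fin n) ℤ Γ.H1) (s : Fin n → E)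
    (hs : ∀ h ∈ Γ.H1, (∀ i, h (s i) = 0) → h = 0) :
    1 ≤ ((edgeMatrix b).submatrix s id).det ^ 2 := by
  set M : Matrix (Fin n) (Fin n) ℤ := Matrix.of fun i j => (b j : E → ℤ) (s i) with hM
  have hcast : (edgeMatrix b).submatrix s id = M.map (Int.castRingHom ℝ) := by
    ext i j; simp [edgeMatrix, hM]
  have hdet : M.det ≠ 0 := by
    intro h0
    obtain ⟨v, hv0, hv⟩ := Matrix.exists_mulVec_eq_zero_iff.mpr h0
    refine hv0 ?_
    have hli := b.linearIndependent.map' Γ.H1.subtype (Submodule.ker_subtype _)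
    refine funext (Fintype.linearIndependent_iff.mp hli v ?_)
    refine hs _ (Submodule.sum_mem _ fun j _ => Submodule.smul_mem _ _ (b j).2) fun i => ?_
    have := congrFun hv i
    simpa [hM, Matrix.mulVec, dotProduct, mul_comm] using this
  rw [hcast, ← RingHom.mapMatrix_apply, ← RingHom.map_det, eq_intCast]
  have : 0 < M.det ^ 2 := by positivity
  exact_mod_cast this

lemma exists_edgeMatrix_minor (hΓ : Γ.IsPrimitiveLogDivergent) (b : Module.Basis (Fin n) ℤ Γ.H1)
    (A : E → ℝ) (hA : ∀ e, 0 < A e) :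
    ∃ s : Fin n → E, Function.Injective s ∧ 1 ≤ ((edgeMatrix b).submatrix s id).det ^ 2 ∧
      ∀ e f, A e / A f * ∏ g, A g ≤ (∏ i, A (s i)) ^ 2 := by
  obtain ⟨S, hS1, hS2, hS3⟩ := exists_edges_prod_sq_ge hΓ A hA
  have hn : Γ.loopNumber = n := by
    rw [loopNumber, Module.finrank_eq_card_basis b, Fintype.card_fin]
  let τ : S ≃ Fin n := Fintype.equivFinOfCardEq (by rw [Fintype.card_coe, hS1, hn])
  refine ⟨fun i => τ.symm i, Subtype.val_injective.comp τ.symm.injective,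
    one_le_det_edgeMatrix_submatrix_sq b _ fun h hh h0 => hS2 h hh fun e he => ?_, fun e f => ?_⟩
  · simpa using h0 (τ ⟨e, he⟩)
  · rw [Equiv.prod_comp τ.symm fun g : S => A g, Finset.prod_coe_sort S A]
    exact hS3 e f

lemma edgeMatrix_mulVec_injective (hΓ : Γ.IsPrimitiveLogDivergent)
    (b : Module.Basis (Fin n) ℤ Γ.H1) : Function.Injective (edgeMatrix b).mulVec := by
  obtain ⟨s, -, hs, -⟩ := exists_edgeMatrix_minor hΓ b (fun _ => 1) (fun _ => one_pos)
  have hinj : Function.Injective ((edgeMatrix b).submatrix s id).mulVec := by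
    refine Matrix.mulVec_injective_iff_isUnit.mpr ((Matrix.isUnit_iff_isUnit_det _).mpr ?_)
    refine isUnit_iff_ne_zero.mpr fun h0 => ?_
    rw [h0] at hs
    norm_num at hs
  intro x y hxy
  refine hinj (funext fun i => ?_)
  exact congrFun hxy (s i)

/-- The growth of the determinant on the positive orthant that makes `1 / Ψ²` integrable. With `s`
the greedy choice, the determinant is at least the product of the `A (s i)`: the part of the
quadratic form given by the edges `s i` is smaller, so its Gaussian integral is larger. -/
lemma div_mul_prod_le_det_sq [DecidableEq E] (hΓ : Γ.IsPrimitiveLogDivergent)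
    (b : Module.Basis (Fin n) ℤ Γ.H1) (A : E → ℝ) (hA : ∀ e, 0 < A e) (e f : E) :
    A e / A f * ∏ g, A g ≤
      ((edgeMatrix b).transpose * Matrix.diagonal A * edgeMatrix b).det ^ 2 := by
  obtain ⟨s, hinj, hs, hef⟩ := exists_edgeMatrix_minor hΓ b A hA
  refine (hef e f).trans ?_
  obtain ⟨hG, hpos⟩ := lintegral_exp_neg_weighted_sum (edgeMatrix b)
    (edgeMatrix_mulVec_injective hΓ b) A hA
  set D := ((edgeMatrix b).transpose * Matrix.diagonal A * edgeMatrix b).det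
  -- `|C x|²` is the part of the quadratic form given by the edges `s i`
  set C := Matrix.diagonal (fun i => √(A (s i))) * (edgeMatrix b).submatrix s id with hC
  have hprod : 0 < ∏ i, A (s i) := Finset.prod_pos fun i _ => hA _
  have hCdet : ∏ i, A (s i) ≤ C.det ^ 2 := by
    rw [hC, Matrix.det_mul, Matrix.det_diagonal, mul_pow, ← Finset.prod_pow]
    simp_rw [Real.sq_sqrt (hA _).le]
    exact le_mul_of_one_le_right hprod.le hs
  have hC0 : C.det ≠ 0 := fun h => by
    rw [h] at hCdet
    linarith [hCdet, zero_pow (M₀ := ℝ) two_ne_zero]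
  have hG2 := lintegral_exp_neg_sum_mulVec_sq_four C hC0
  have hle : ∀ Z : Fin n × Fin 4 → ℝ,
      ∑ a, ∑ i, C.mulVec (fun k => Z (k, a)) i ^ 2 ≤
        ∑ e, A e * ∑ a, (edgeMatrix b).mulVec (fun k => Z (k, a)) e ^ 2 := by
    intro Z
    rw [Finset.sum_comm]
    have h1 : ∀ i, ∑ a, C.mulVec (fun k => Z (k, a)) i ^ 2 =
        A (s i) * ∑ a, (edgeMatrix b).mulVec (fun k => Z (k, a)) (s i) ^ 2 := by
      intro i
      rw [Finset.mul_sum]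
      refine Finset.sum_congr rfl fun a _ => ?_
      rw [hC, ← Matrix.mulVec_mulVec, Matrix.mulVec_diagonal, mul_pow, Real.sq_sqrt (hA _).le]
      rfl
    simp_rw [h1]
    refine (Finset.sum_map Finset.univ ⟨s, hinj⟩ fun e =>
      A e * ∑ a, (edgeMatrix b).mulVec (fun k => Z (k, a)) e ^ 2).symm.trans_le ?_
    exact Finset.sum_le_sum_of_subset_of_nonneg (Finset.subset_univ _) fun e _ _ =>
      mul_nonneg (hA e).le (Finset.sum_nonneg fun a _ => sq_nonneg _)
  have hmono := lintegral_mono (μ := volume) fun Z =>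
    ENNReal.ofReal_le_ofReal (Real.exp_le_exp.mpr (neg_le_neg (hle Z)))
  rw [hG, hG2, ENNReal.ofReal_le_ofReal_iff (by positivity),
    div_le_div_iff_of_pos_left (by positivity) (by positivity) (by positivity)] at hmono
  calc (∏ i, A (s i)) ^ 2 ≤ (C.det ^ 2) ^ 2 := pow_le_pow_left₀ hprod.le hCdet 2
    _ = C.det ^ 4 := by ring
    _ ≤ D ^ 2 := hmono

end OrientedGraph

/-! ### The dominating function in a chart -/

lemma integrableOn_min_rpow_mul_inv {δ : ℝ} (hδ : 0 < δ) :
    IntegrableOn (fun a : ℝ => (min a a⁻¹) ^ δ * a⁻¹) (Set.Ioi 0) := by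
  rw [← Set.Ioc_union_Ioi_eq_Ioi zero_le_one]
  refine IntegrableOn.union ?_ ?_
  · have h := (intervalIntegral.intervalIntegrable_rpow' (a := 0) (b := 1) (r := δ - 1)
      (by linarith)).1
    refine h.congr_fun (fun a ha => ?_) measurableSet_Ioc
    have h1 : a ≤ a⁻¹ := ha.2.trans ((one_le_inv₀ ha.1).mpr ha.2)
    simp only [min_eq_left h1]
    rw [Real.rpow_sub_one ha.1.ne', div_eq_mul_inv]
  · have h := integrableOn_Ioi_rpow_of_lt (a := -δ - 1) (by linarith) one_pos
    refine h.congr_fun (fun a (ha : 1 < a) => ?_) measurableSet_Ioi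
    have h0 : 0 < a := one_pos.trans ha
    have h1 : a⁻¹ ≤ a := (inv_le_one_of_one_le₀ ha.le).trans ha.le
    simp only [min_eq_right h1]
    rw [Real.rpow_sub_one h0.ne', div_eq_mul_inv, Real.rpow_neg h0.le, Real.inv_rpow h0.le]

lemma prod_chartPoint {ι : Type*} [Fintype ι] [DecidableEq ι] (i₀ : ι)
    (z : {i // i ≠ i₀} → ℝ) : ∏ i, chartPoint i₀ z i = ∏ i, z i := by
  rw [← Finset.mul_prod_erase _ _ (Finset.mem_univ i₀),
    Finset.prod_subtype (p := fun i => i ≠ i₀) (F := inferInstance) _ (by simp)]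
  have : ∀ i : {i // i ≠ i₀}, chartPoint i₀ z i = z i := fun i => by simp [chartPoint, i.2]
  simp_rw [this]
  simp [chartPoint]

lemma restrict_nonneg_eq_restrict_pos {ι : Type*} [Fintype ι] :
    (volume : Measure (ι → ℝ)).restrict {z | ∀ i, 0 ≤ z i} =
      volume.restrict {z | ∀ i, 0 < z i} := by
  have h1 : {z : ι → ℝ | ∀ i, 0 < z i} = Set.univ.pi fun _ => Set.Ioi 0 := by ext; simp
  have h2 : {z : ι → ℝ | ∀ i, 0 ≤ z i} = Set.Ici fun _ => 0 := by ext; simp [Pi.le_def]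
  rw [h1, h2]
  exact (Measure.restrict_congr_set Measure.univ_pi_Ioi_ae_eq_Ici).symm

namespace OrientedGraph

variable {V E : Type*} [DecidableEq V] [Fintype E] {Γ : OrientedGraph V E} {n : ℕ}

lemma loopNumber_eq (b : Module.Basis (Fin n) ℤ Γ.H1) : Γ.loopNumber = n := by
  rw [loopNumber, Module.finrank_eq_card_basis b, Fintype.card_fin]

/-! ### Convergence of the parametric integral -/

lemma lintegral_schwingerIntegrand_lt_top [DecidableEq E] (hΓ : Γ.IsPrimitiveLogDivergent)
    (hn : 1 ≤ n) (b : Module.Basis (Fin n) ℤ Γ.H1) (e₀ : E) :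
    ∫⁻ z in {z : {e // e ≠ e₀} → ℝ | ∀ i, 0 < z i},
      ENNReal.ofReal (schwingerIntegrand b (chartPoint e₀ z)) < ⊤ := by
  have hE : Fintype.card E = 2 * n := by rw [← loopNumber_eq b]; exact hΓ.1
  have hm : 0 < (Fintype.card {e // e ≠ e₀} : ℝ) := by
    have : Fintype.card {e // e ≠ e₀} = Fintype.card E - 1 := by
      simp [Fintype.card_subtype_compl]
    exact_mod_cast (by omega : 0 < Fintype.card {e // e ≠ e₀})
  set m : ℝ := (Fintype.card {e // e ≠ e₀} : ℝ) with hm_def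
  have hvol : (volume : Measure ({e // e ≠ e₀} → ℝ)).restrict {z | ∀ e, 0 < z e} =
      Measure.pi fun _ => volume.restrict (Set.Ioi (0 : ℝ)) := by
    have hset : {z : {e // e ≠ e₀} → ℝ | ∀ e, 0 < z e} = Set.univ.pi fun _ => Set.Ioi 0 := by
      ext; simp
    rw [hset, volume_pi, Measure.restrict_pi_pi]
  have hint : Integrable (fun z : {e // e ≠ e₀} → ℝ =>
      ∏ e, ((min (z e) (z e)⁻¹) ^ (1 / m) * (z e)⁻¹))
      (volume.restrict {z | ∀ e, 0 < z e}) := by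
    rw [hvol]
    exact Integrable.fintype_prod_dep
      (f := fun _ a => (min a a⁻¹) ^ (1 / m) * a⁻¹)
      fun _ => integrableOn_min_rpow_mul_inv (by positivity)
  refine lt_of_le_of_lt (setLIntegral_mono' measurableSet_pos fun z hz => ?_)
    hint.lintegral_lt_top
  refine ENNReal.ofReal_le_ofReal ?_
  have hz : ∀ e, 0 < z e := hz
  have hA := chartPoint_pos e₀ hz
  have hbound := div_mul_prod_le_det_sq hΓ b (chartPoint e₀ z) hA
  rw [← aeval_graphPolynomial, prod_chartPoint] at hbound
  rw [schwingerIntegrand]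
  set D := (MvPolynomial.aeval (chartPoint e₀ z) (Γ.graphPolynomial b)) ^ 2
  have hP : 0 < ∏ e, z e := Finset.prod_pos fun e _ => hz e
  have hD : 0 < D := lt_of_lt_of_le
    (by rw [div_self (hA e₀).ne', one_mul]; exact hP) (hbound e₀ e₀)
  -- `ρ` is at most each of the factors `min (z e) (1 / z e)`, hence at most their geometric mean
  set ρ := (∏ e, z e) / D with hρ
  have hρ0 : 0 < ρ := div_pos hP hD
  have hw : ∀ e, ρ ≤ min (z e) (z e)⁻¹ := by
    intro e
    have h0 : chartPoint e₀ z e₀ = 1 := by simp [chartPoint]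
    have h1 : chartPoint e₀ z e = z e := by simp [chartPoint, e.2]
    have h2 := hbound e₀ e
    have h3 := hbound e e₀
    rw [h0, h1] at h2 h3
    have hze := hz e
    rw [le_min_iff, hρ, div_le_iff₀ hD, div_le_iff₀ hD]
    constructor
    · rwa [one_div, inv_mul_le_iff₀ hze] at h2
    · rwa [div_one, ← le_inv_mul_iff₀ hze] at h3
  have hprod : ρ ≤ ∏ e : {e // e ≠ e₀}, (min (z e) (z e)⁻¹) ^ (1 / m) := by
    calc ρ = ∏ e : {e // e ≠ e₀}, ρ ^ (1 / m) := by
          rw [Finset.prod_const, Finset.card_univ, ← Real.rpow_mul_natCast hρ0.le, ← hm_def,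
            one_div_mul_cancel hm.ne', Real.rpow_one]
      _ ≤ _ := Finset.prod_le_prod (fun e _ => by positivity) fun e _ =>
          Real.rpow_le_rpow hρ0.le (hw e) (by positivity)
  rw [Finset.prod_mul_distrib, Finset.prod_inv_distrib, ← div_eq_mul_inv, le_div_iff₀ hP]
  calc 1 / D * ∏ e, z e = ρ := by rw [hρ]; ring
    _ ≤ _ := hprod

/-! ### Evaluation of the period -/

/-- There are no bridges: deleting an edge which lies on no cycle would leave a subgraph with
`2n - 1` edges and `n` loops. -/
lemma exists_basis_apply_ne_zero (hΓ : Γ.IsPrimitiveLogDivergent) (hn : 1 ≤ n)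
    (b : Module.Basis (Fin n) ℤ Γ.H1) (e : E) : ∃ i, (b i : E → ℤ) e ≠ 0 := by
  classical
  by_contra! h
  have hE : Fintype.card E = 2 * n := by rw [← loopNumber_eq b]; exact hΓ.1
  have hcard : (Finset.univ.erase e).card = 2 * n - 1 := by
    rw [Finset.card_erase_of_mem (Finset.mem_univ e), Finset.card_univ, hE]
  have hconv := hΓ.2 (Finset.univ.erase e) (Finset.card_pos.mp (by omega))
    (Finset.erase_ssubset (Finset.mem_univ e)).ne
  rw [IsConvergent, Fintype.card_coe, hcard] at hconv
  have hle := finrank_cyclesVanishingOn_compl_le (Γ := Γ) (Finset.univ.erase e)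
  have htop : Γ.cyclesVanishingOn {e' | e' ∉ Finset.univ.erase e} = ⊤ := by
    refine eq_top_iff.mpr fun g _ e' he' => ?_
    have he' : e' = e := by simpa using he'
    rw [he', ← b.sum_repr g, Submodule.coe_sum, Finset.sum_apply]
    exact Finset.sum_eq_zero fun i _ => by simp [h i]
  have := loopNumber_eq b
  rw [htop, finrank_top] at hle
  rw [loopNumber] at this
  omega

lemma feynmanQuadric_eq_mulVec (b : Module.Basis (Fin n) ℤ Γ.H1) (e : E)
    (Z : Fin n × Fin 4 → ℝ) :
    feynmanQuadric ℝ b e Z = ∑ a, (edgeMatrix b).mulVec (fun i => Z (i, a)) e ^ 2 := by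
  simp_rw [feynmanQuadric_apply, edgeForm_eq_mulVec]

/-- The zero locus of `q_e` in a chart lies in a hyperplane, given by the vanishing of `ℓ_e` on a
summand `H` other than the one whose coordinate is set to `1`. -/
lemma ae_feynmanQuadric_chartPoint_pos (hΓ : Γ.IsPrimitiveLogDivergent) (hn : 1 ≤ n)
    (b : Module.Basis (Fin n) ℤ Γ.H1) (j₀ : Fin n × Fin 4) :
    ∀ᵐ z, ∀ e, 0 < feynmanQuadric ℝ b e (chartPoint j₀ z) := by
  rw [ae_all_iff]
  intro e
  obtain ⟨i, hi⟩ := exists_basis_apply_ne_zero hΓ hn b e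
  obtain ⟨a, ha⟩ := exists_ne j₀.2
  have hne : ∀ k, (k, a) ≠ j₀ := fun k h => ha (by rw [← h])
  let f : ({j // j ≠ j₀} → ℝ) →ₗ[ℝ] ℝ :=
    edgeForm ℝ b e ∘ₗ LinearMap.funLeft ℝ ℝ fun k => (⟨(k, a), hne k⟩ : {j // j ≠ j₀})
  have hf : LinearMap.ker f ≠ ⊤ := by
    intro h
    have h1 : f (Pi.single ⟨(i, a), hne i⟩ 1) = 0 := by
      rw [LinearMap.ker_eq_top.mp h]; rfl
    refine hi (Int.cast_injective (α := ℝ) ?_)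
    rw [Int.cast_zero, ← h1]
    simp [f, edgeForm_apply, LinearMap.funLeft_apply, Pi.single_apply, Prod.ext_iff]
  have hnull := Measure.addHaar_submodule volume _ hf
  refine measure_mono_null (fun z hz => ?_) hnull
  by_contra hfz
  refine hz ?_
  have hfz' : edgeForm ℝ b e (fun k => chartPoint j₀ z (k, a)) ≠ 0 := by
    have : (fun k => chartPoint j₀ z (k, a)) = fun k => z ⟨(k, a), hne k⟩ :=
      funext fun k => by simp [chartPoint, hne k]
    rw [this]
    exact hfz
  show 0 < feynmanQuadric ℝ b e (chartPoint j₀ z)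
  rw [feynmanQuadric_apply]
  exact Finset.sum_pos' (fun _ _ => sq_nonneg _) ⟨a, Finset.mem_univ a, by positivity⟩

lemma lintegral_quadricIntegrand [DecidableEq E] (hΓ : Γ.IsPrimitiveLogDivergent) (hn : 1 ≤ n)
    (b : Module.Basis (Fin n) ℤ Γ.H1) (j₀ : Fin n × Fin 4) (e₀ : E) :
    ∫⁻ z, ENNReal.ofReal (quadricIntegrand b (chartPoint j₀ z)) =
      ENNReal.ofReal (Real.pi ^ (2 * n)) *
        ∫⁻ a in {a : {e // e ≠ e₀} → ℝ | ∀ e, 0 < a e},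
          ENNReal.ofReal (schwingerIntegrand b (chartPoint e₀ a)) := by
  have hE : Fintype.card E = 2 * n := by rw [← loopNumber_eq b]; exact hΓ.1
  rw [← lintegral_const_mul' _ _ ENNReal.ofReal_ne_top]
  refine (lintegral_one_div_prod_chart (fun e Z => feynmanQuadric ℝ b e Z) (fun e => ?_)
    (fun e s Z => ?_) (by simp [hE]; ring) j₀ e₀
    (ae_feynmanQuadric_chartPoint_pos hΓ hn b j₀)).trans ?_
  · simp only [feynmanQuadric_eq_mulVec, Matrix.mulVec, dotProduct]
    fun_prop
  · simp [QuadraticMap.map_smul, sq]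
  · refine setLIntegral_congr_fun measurableSet_pos fun a ha => ?_
    simp only [feynmanQuadric_eq_mulVec]
    rw [(lintegral_exp_neg_weighted_sum (edgeMatrix b) (edgeMatrix_mulVec_injective hΓ b) _
      (chartPoint_pos e₀ ha)).1, schwingerIntegrand, aeval_graphPolynomial,
      ← ENNReal.ofReal_mul (by positivity), Fintype.card_fin, mul_one_div]

lemma quadricIntegrand_nonneg (b : Module.Basis (Fin n) ℤ Γ.H1) (Z : Fin n × Fin 4 → ℝ) :
    0 ≤ quadricIntegrand b Z := by
  refine one_div_nonneg.mpr (Finset.prod_nonneg fun e _ => ?_)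
  rw [feynmanQuadric_apply]
  positivity

lemma measurable_quadricIntegrand (b : Module.Basis (Fin n) ℤ Γ.H1) :
    Measurable (quadricIntegrand b) := by
  unfold quadricIntegrand
  simp only [feynmanQuadric_eq_mulVec, Matrix.mulVec, dotProduct]
  fun_prop

lemma measurable_schwingerIntegrand [DecidableEq E] (b : Module.Basis (Fin n) ℤ Γ.H1) :
    Measurable (schwingerIntegrand b) := by
  unfold schwingerIntegrand
  simp only [aeval_graphPolynomial]
  refine Measurable.div measurable_const (Continuous.measurable ?_)
  fun_prop

end OrientedGraph

theorem mainTheorem5 {V E : Type*} [Finite V] [DecidableEq V] [Fintype E] [DecidableEq E]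
    (Γ : OrientedGraph V E) (hΓ : Γ.IsPrimitiveLogDivergent) (n : ℕ) (hn : 1 ≤ n)
    (b : Module.Basis (Fin n) ℤ Γ.H1) :
    (∀ e : E, (OrientedGraph.feynmanQuadric ℚ b e).toMatrix' =
      Matrix.blockDiagonal fun _ : Fin 4 => (OrientedGraph.edgeSquare ℚ b e).toMatrix') ∧
    (Γ.graphPolynomial b).map (Int.castRingHom ℚ) =
      discriminantPolynomial (fun e => (OrientedGraph.edgeSquare ℚ b e).toMatrix') ∧
    discriminantPolynomial (fun e => (OrientedGraph.feynmanQuadric ℚ b e).toMatrix') =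
      ((Γ.graphPolynomial b).map (Int.castRingHom ℚ)) ^ 4 ∧
    (∀ j₀ : Fin n × Fin 4, ProjectiveIntegrable j₀ (OrientedGraph.quadricIntegrand b)) ∧
    (∀ e₀ : E, SimplexIntegrable e₀ (OrientedGraph.schwingerIntegrand b)) ∧
    ∃ c : ℚ, c ≠ 0 ∧ ∀ (j₀ : Fin n × Fin 4) (e₀ : E),
      OrientedGraph.period b j₀ =
        c * Real.pi ^ (2 * n) * simplexIntegral e₀ (OrientedGraph.schwingerIntegrand b) := by
  have hE : Fintype.card E = 2 * n := by rw [← OrientedGraph.loopNumber_eq b]; exact hΓ.1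
  have hmq : ∀ j₀, Measurable fun z => OrientedGraph.quadricIntegrand b (chartPoint j₀ z) :=
    fun j₀ => (OrientedGraph.measurable_quadricIntegrand b).comp
      (continuous_chartPoint j₀).measurable
  have hms : ∀ e₀, Measurable fun z => OrientedGraph.schwingerIntegrand b (chartPoint e₀ z) :=
    fun e₀ => (OrientedGraph.measurable_schwingerIntegrand b).comp
      (continuous_chartPoint e₀).measurable
  have hsn : ∀ A, 0 ≤ OrientedGraph.schwingerIntegrand b A := fun A =>
    one_div_nonneg.mpr (sq_nonneg _)
  refine ⟨OrientedGraph.feynmanQuadric_toMatrix' b, OrientedGraph.graphPolynomial_map b, ?_,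
    fun j₀ => ?_, fun e₀ => ?_, 1, one_ne_zero, fun j₀ e₀ => ?_⟩
  · simp_rw [OrientedGraph.feynmanQuadric_toMatrix',
      OrientedGraph.discriminantPolynomial_blockDiagonal,
      OrientedGraph.graphPolynomial_map, Fintype.card_fin]
  · obtain ⟨e₀⟩ : Nonempty E := Fintype.card_pos_iff.mp (by omega)
    refine ⟨(hmq j₀).aestronglyMeasurable, ?_⟩
    rw [hasFiniteIntegral_iff_ofReal
      (Filter.Eventually.of_forall fun z => OrientedGraph.quadricIntegrand_nonneg b _),
      OrientedGraph.lintegral_quadricIntegrand hΓ hn b j₀ e₀]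
    exact ENNReal.mul_lt_top ENNReal.ofReal_lt_top
      (OrientedGraph.lintegral_schwingerIntegrand_lt_top hΓ hn b e₀)
  · refine ⟨(hms e₀).aestronglyMeasurable, ?_⟩
    rw [hasFiniteIntegral_iff_ofReal (Filter.Eventually.of_forall fun z => hsn _),
      restrict_nonneg_eq_restrict_pos]
    exact OrientedGraph.lintegral_schwingerIntegrand_lt_top hΓ hn b e₀
  · rw [OrientedGraph.period, projectiveIntegral, simplexIntegral,
      restrict_nonneg_eq_restrict_pos,
      integral_eq_lintegral_of_nonneg_ae
        (Filter.Eventually.of_forall fun z => OrientedGraph.quadricIntegrand_nonneg b _)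
        (hmq j₀).aestronglyMeasurable,
      integral_eq_lintegral_of_nonneg_ae (Filter.Eventually.of_forall fun z => hsn _)
        (hms e₀).aestronglyMeasurable,
      OrientedGraph.lintegral_quadricIntegrand hΓ hn b j₀ e₀, ENNReal.toReal_mul,
      ENNReal.toReal_ofReal (by positivity)]
    simp
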